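/- **Setting.** Let $k$ be a commutative unital ring, $\otimes=\otimes_k$, and let $H$ be a Hopf algebra over $k$ with multiplication $\mu_H$, unit $\eta_H$, comultiplication $\Delta_H$, counit $\varepsilon_H$ and antipode $\sigma_H$. Let $S$ be a (right) $H$-comodule algebra with coaction $\Delta_S$, i.e. a $k$-algebra with a coassociative counital coaction $S\to S\otimes H$ that is a morphism of algebras. Let $M$ be an $(H,S)$-Hopf module, i.e. a right $S$-module with a $k$-linear coassociative counital coaction $\Delta_M:M\to M\otimes H$ such that $\Delta_M(ms)=\Delta_M(m)\Delta_S(s)$. **General cohomology.** For an $H$-comodule algebra $E$ with coaction $\Delta_E$ define algebra morphisms $d^0=\Delta_E$, $d^1(x)=x\otimes 1$ from $E$ to $E\otimes H$, and $d^0=\Delta_E\otimes\mathrm{id}_H$, $d^1=\mathrm{id}_E\otimes\Delta_H$, $d^2(X)=X\otimes 1$ from $E\otimes H$ to $E\otimes H\otimes H$. On invertible elements they form a pre-cosimplicial group $\mathcal C^\times(H,E)=\bigl(E^\times\rightrightarrows(E\otimes H)^\times\to(E\otimes H\otimes H)^\times\bigr)$ (truncated in degrees $\le 2$). Put $\mathcal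 H^0(H,E)=\{x\in E^\times\mid d^1x=d^0x\}$ and let $\mathcal H^1(H,E)$ be the quotient of $\mathcal Z^1(H,E)=\{X\in(E\otimes H)^\times\mid d^2(X)d^0(X)=d^1(X)\}$ by the right action $X\leftharpoonup x=(d^1x^{-1})\,X\,(d^0x)$ of $E^\times$, pointed by the class of $1$. **Restricted cohomology.** Let $W_k^n(M)=\mathrm{Hom}_k(M,M\otimes H^{\otimes n})$, with the algebra structure given for $n=0$ by composition and for $n>0$ by $\Phi\cdot\Psi=(\mathrm{id}_M\otimes\mu_{H^{\otimes n}})\circ(\Phi\otimes\mathrm{id}_{H^{\otimes n}})\circ\Psi$, whose unit is $m\mapsto m\otimes 1$. Let $W_S^n(M)=\mathrm{Hom}_S(M,M\otimes H^{\otimes n})$ be the subalgebra of $S$-linear maps, where $(m\otimes h)s=ms\otimes h$; so $W_S^0(M)=\mathrm{End}_S(M)$. For $\varphi\in W_k^0(M)$ and $\Phi\in W_k^1(M)$ put $$b^0\varphi=(\mathrm{id}_M\otimes\mu_H)(\Delta_M\otimes\mathrm{id}_H)(\varphi\otimes\sigma_H)\Delta_M,\qquad b^1\varphi=(\mathrm{id}_M\otimes\eta_H)\varphi,$$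 $$b^0\Phi=(\mathrm{id}_M\otimes\mu_H\otimes\mathrm{id}_H)(\Delta_M\otimes T)(\Phi\otimes\sigma_H)\Delta_M,\quad b^1\Phi=(\mathrm{id}_M\otimes\Delta_H)\Phi,\quad b^2\Phi=\Phi\otimes\eta_H,$$ where $T$ is the flip of $H\otimes H$. These maps preserve $S$-linearity, and on invertible elements they form a pre-cosimplicial group $\mathcal W^\times(H,M)=\bigl(W_S^0(M)^\times\rightrightarrows W_S^1(M)^\times\to W_S^2(M)^\times\bigr)$. With $\mathrm{Aut}_S(M)=\mathrm{End}_S(M)^\times$ put $H^0(H,M)=\{\varphi\in\mathrm{Aut}_S(M)\mid b^1\varphi=b^0\varphi\}$, and let $H^1(H,M)$ be the quotient of $$Z^1(H,M)=\{\Phi\in W_k^1(M)\mid \Phi(ms)=\Phi(m)s\ (m\in M,\,s\in S),\ (\mathrm{id}_M\otimes\varepsilon_H)\circ\Phi=\mathrm{id}_M,\ b^2\Phi\cdot b^0\Phi=b^1\Phi\}$$ by the right action $\Phi\leftharpoonup f=b^1f^{-1}\cdot\Phi\cdot b^0f$ of $\mathrm{Aut}_S(M)$, pointed by the class of $\mathrm{id}_M\otimes\eta_H$.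 **Theorem.** Let $\omega_n:\mathrm{End}_S(M)\otimes H^{\otimes n}\to W_S^n(M)$ be the algebra morphism $\omega_n(f\otimes h)(m)=f(m)\otimes h$, and assume that $\omega_n$ is an isomorphism of algebras for $0\le n\le 2$ (for $n=0$ this is automatic, $\omega_0$ being the identity of $\mathrm{End}_S(M)$). Then: 1. $\Delta_{\mathrm{End}_S(M)}=\omega_1^{-1}\circ b^0:\mathrm{End}_S(M)\to\mathrm{End}_S(M)\otimes H$ makes $\mathrm{End}_S(M)$ an $H$-comodule algebra. 2. For this structure, $\omega_0,\omega_1,\omega_2$ induce an isomorphism of pre-cosimplicial groups $\mathcal C^\times(H,\mathrm{End}_S(M))\cong\mathcal W^\times(H,M)$. 3. $\mathcal H^0(H,\mathrm{End}_S(M))=H^0(H,M)$ as groups (as subgroups of $\mathrm{End}_S(M)^\times=\mathrm{Aut}_S(M)$). 4. $\omega_1$ induces an isomorphism of pointed sets $\mathcal H^1(H,\mathrm{End}_S(M))\cong H^1(H,M)$, sending the class of $X$ to the class of $\omega_1(X)$. -/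

import Mathlib

open scoped TensorProduct

noncomputable section

namespace HopfCoh

universe u v w

/-! ### Non-abelian cohomology of a pre-cosimplicial group -/

/-- A pre-cosimplicial group, truncated in degrees `≤ 2`. The coface maps are subject to
`dⁱ dʲ = dʲ dⁱ⁻¹` for `i > j`; `c0, c1` are the coface maps from degree `0` to degree `1`, and
`d0, d1, d2` those from degree `1` to degree `2`. -/
structure PreCosimplicialGroup (A₀ : Type u) (A₁ : Type v) (A₂ : Type w)
    [Group A₀] [Group A₁] [Group A₂] where
  c0 : A₀ →* A₁
  c1 : A₀ →* A₁
  d0 : A₁ →* A₂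
  d1 : A₁ →* A₂
  d2 : A₁ →* A₂
  d1_c0 : ∀ x, d1 (c0 x) = d0 (c0 x)
  d2_c0 : ∀ x, d2 (c0 x) = d0 (c1 x)
  d2_c1 : ∀ x, d2 (c1 x) = d1 (c1 x)

namespace PreCosimplicialGroup

variable {A₀ A₁ A₂ : Type*} [Group A₀] [Group A₁] [Group A₂]

/-- The non-abelian `0`-cohomology group `{x | d¹ x = d⁰ x}`. -/
def H0 (P : PreCosimplicialGroup A₀ A₁ A₂) : Subgroup A₀ := P.c1.eqLocus P.c0

/-- The set of `1`-cocycles `{X | d²(X) d⁰(X) = d¹(X)}`. -/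
def Z1 (P : PreCosimplicialGroup A₀ A₁ A₂) : Set A₁ := {X | P.d2 X * P.d0 X = P.d1 X}

/-- Two `1`-cocycles are cohomologous if they lie in the same orbit of the right action
`X ↼ x = d¹(x⁻¹) X d⁰(x)` of `A₀`. -/
def cohomologous (P : PreCosimplicialGroup A₀ A₁ A₂) : Setoid P.Z1 where
  r X Y := ∃ x : A₀, (Y : A₁) = P.c1 x⁻¹ * X * P.c0 x
  iseqv :=
    { refl := fun X => ⟨1, by simp⟩
      symm := by
        rintro X Y ⟨x, h⟩
        exact ⟨x⁻¹, by simp [h, mul_assoc]⟩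
      trans := by
        rintro X Y Z ⟨x, h⟩ ⟨y, h'⟩
        exact ⟨x * y, by simp [h, h', mul_assoc]⟩ }

/-- The non-abelian `1`-cohomology set. -/
def H1 (P : PreCosimplicialGroup A₀ A₁ A₂) : Type _ := Quotient P.cohomologous

/-- The class of a `1`-cocycle. -/
def H1.mk (P : PreCosimplicialGroup A₀ A₁ A₂) (X : P.Z1) : P.H1 := Quotient.mk P.cohomologous X

/-- The distinguished point of the `1`-cohomology set: the class of the neutral element. -/
def H1.base (P : PreCosimplicialGroup A₀ A₁ A₂) : P.H1 :=
  H1.mk P ⟨1, by simp [Z1]⟩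

/-- An isomorphism of (truncated) pre-cosimplicial groups. -/
structure Iso {B₀ B₁ B₂ : Type*} [Group B₀] [Group B₁] [Group B₂]
    (P : PreCosimplicialGroup A₀ A₁ A₂) (Q : PreCosimplicialGroup B₀ B₁ B₂) where
  e₀ : A₀ ≃* B₀
  e₁ : A₁ ≃* B₁
  e₂ : A₂ ≃* B₂
  comm_c0 : ∀ x, e₁ (P.c0 x) = Q.c0 (e₀ x)
  comm_c1 : ∀ x, e₁ (P.c1 x) = Q.c1 (e₀ x)
  comm_d0 : ∀ X, e₂ (P.d0 X) = Q.d0 (e₁ X)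
  comm_d1 : ∀ X, e₂ (P.d1 X) = Q.d1 (e₁ X)
  comm_d2 : ∀ X, e₂ (P.d2 X) = Q.d2 (e₁ X)

end PreCosimplicialGroup

/-! ### Comodule algebras and general non-abelian Hopf cohomology -/

open Coalgebra HopfAlgebra

/-- A structure of (right) `H`-comodule algebra on the `k`-algebra `E`: a coassociative and
counital coaction `E → E ⊗ H` which is a morphism of algebras. -/
structure ComoduleAlgebra (k H E : Type*) [CommRing k] [Ring H] [HopfAlgebra k H]
    [Ring E] [Algebra k E] where
  coact : E →ₐ[k] E ⊗[k] H
  coassoc : ∀ x, TensorProduct.assoc k E H H (coact.toLinearMap.rTensor H (coact x)) =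
    (comul (R := k) (A := H)).lTensor E (coact x)
  counital : ∀ x, TensorProduct.rid k E ((counit (R := k) (A := H)).lTensor E (coact x)) = x

namespace ComoduleAlgebra

variable {k H E : Type*} [CommRing k] [Ring H] [HopfAlgebra k H] [Ring E] [Algebra k E]

/-- `d⁰ = Δ_E ⊗ id_H : E ⊗ H → E ⊗ H ⊗ H`. -/
def d0 (C : ComoduleAlgebra k H E) : E ⊗[k] H →ₐ[k] E ⊗[k] (H ⊗[k] H) :=
  (Algebra.TensorProduct.assoc k k k E H H).toAlgHom.comp
    (Algebra.TensorProduct.map C.coact (AlgHom.id k H))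

variable (k H E) in
/-- `d¹ = id_E ⊗ Δ_H : E ⊗ H → E ⊗ H ⊗ H`. -/
def d1 : E ⊗[k] H →ₐ[k] E ⊗[k] (H ⊗[k] H) :=
  Algebra.TensorProduct.map (AlgHom.id k E) (Bialgebra.comulAlgHom k H)

variable (k H E) in
/-- `d² : X ↦ X ⊗ 1`, from `E ⊗ H` to `E ⊗ H ⊗ H`. -/
def d2 : E ⊗[k] H →ₐ[k] E ⊗[k] (H ⊗[k] H) :=
  (Algebra.TensorProduct.assoc k k k E H H).toAlgHom.comp
    Algebra.TensorProduct.includeLeft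

/-- The pre-cosimplicial group `Eˣ ⇉ (E ⊗ H)ˣ ⇶ (E ⊗ H ⊗ H)ˣ`, with
`d⁰(x) = Δ_E(x)` and `d¹(x) = x ⊗ 1` in degree `0`. -/
def unitsDiagram (C : ComoduleAlgebra k H E) :
    PreCosimplicialGroup Eˣ (E ⊗[k] H)ˣ (E ⊗[k] (H ⊗[k] H))ˣ where
  c0 := Units.map (C.coact : E →* E ⊗[k] H)
  c1 := Units.map ((Algebra.TensorProduct.includeLeft : E →ₐ[k] E ⊗[k] H) : E →* E ⊗[k] H)
  d0 := Units.map (C.d0 : E ⊗[k] H →* E ⊗[k] (H ⊗[k] H))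
  d1 := Units.map (d1 k H E : E ⊗[k] H →* E ⊗[k] (H ⊗[k] H))
  d2 := Units.map (d2 k H E : E ⊗[k] H →* E ⊗[k] (H ⊗[k] H))
  d1_c0 x := by
    ext
    exact (C.coassoc x).symm
  d2_c0 x := by
    ext
    simp [d0, d2]
  d2_c1 x := by
    ext
    simp [d1, d2, Algebra.TensorProduct.one_def]

/-- The general non-abelian Hopf `0`-cohomology group `𝓗⁰(H, E)`. -/
def genH0 (C : ComoduleAlgebra k H E) : Subgroup Eˣ := C.unitsDiagram.H0

/-- The set `𝓩¹(H, E)` of Hopf `1`-cocycles of `H` with coefficients in `E`. -/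
def genZ1 (C : ComoduleAlgebra k H E) : Set (E ⊗[k] H)ˣ := C.unitsDiagram.Z1

/-- The general non-abelian Hopf `1`-cohomology set `𝓗¹(H, E)`. -/
def genH1 (C : ComoduleAlgebra k H E) : Type _ := C.unitsDiagram.H1

/-- The class of a Hopf `1`-cocycle. -/
def genH1.mk (C : ComoduleAlgebra k H E) (X : C.genZ1) : C.genH1 :=
  PreCosimplicialGroup.H1.mk C.unitsDiagram X

/-- The distinguished point of `𝓗¹(H, E)`. -/
def genH1.base (C : ComoduleAlgebra k H E) : C.genH1 :=
  PreCosimplicialGroup.H1.base C.unitsDiagram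

end ComoduleAlgebra

/-! ### Hopf modules -/

section Modules

variable (k : Type*) [CommRing k]

/-- Right multiplication `m ↦ m s` as a `k`-bilinear map, for a right `S`-module `M` (that is, a
module over `Sᵐᵒᵖ`). -/
def rsmul (S M : Type*) [Ring S] [Algebra k S] [AddCommGroup M] [Module k M] [Module Sᵐᵒᵖ M]
    [IsScalarTower k Sᵐᵒᵖ M] : M →ₗ[k] S →ₗ[k] M :=
  LinearMap.mk₂ k (fun m s => MulOpposite.op s • m)
    (fun _ _ _ => smul_add _ _ _)
    (fun c m s => (smul_comm c (MulOpposite.op s) m).symm)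
    (fun m s t => by rw [MulOpposite.op_add, add_smul])
    (fun c m s => by rw [MulOpposite.op_smul, smul_assoc])

/-- The product `(m ⊗ a) (s ⊗ b) = m s ⊗ a b`, from `(M ⊗ A) × (S ⊗ A)` to `M ⊗ A`. -/
def tensorAct (A S M : Type*) [Ring A] [Algebra k A] [Ring S] [Algebra k S] [AddCommGroup M]
    [Module k M] [Module Sᵐᵒᵖ M] [IsScalarTower k Sᵐᵒᵖ M] :
    M ⊗[k] A →ₗ[k] S ⊗[k] A →ₗ[k] M ⊗[k] A :=
  TensorProduct.lift
    ((TensorProduct.mapBilinear (.id k) S A M A).compl₁₂ (rsmul k S M) (LinearMap.mul k A))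

@[simp]
theorem tensorAct_tmul (A S M : Type*) [Ring A] [Algebra k A] [Ring S] [Algebra k S]
    [AddCommGroup M] [Module k M] [Module Sᵐᵒᵖ M] [IsScalarTower k Sᵐᵒᵖ M]
    (m : M) (a : A) (s : S) (b : A) :
    tensorAct k A S M (m ⊗ₜ a) (s ⊗ₜ b) = (MulOpposite.op s • m) ⊗ₜ[k] (a * b) := rfl

end Modules

/-- A structure of `(H, S)`-Hopf module on the right `S`-module `M`, for the `H`-comodule algebra
`S`: a coassociative and counital coaction `M → M ⊗ H` such that
`Δ_M(m s) = Δ_M(m) Δ_S(s)`. -/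
structure HopfModule {k H S : Type*} [CommRing k] [Ring H] [HopfAlgebra k H] [Ring S]
    [Algebra k S] (CS : ComoduleAlgebra k H S) (M : Type*) [AddCommGroup M] [Module k M]
    [Module Sᵐᵒᵖ M] [IsScalarTower k Sᵐᵒᵖ M] where
  coact : M →ₗ[k] M ⊗[k] H
  coassoc : ∀ m, TensorProduct.assoc k M H H (coact.rTensor H (coact m)) =
    (comul (R := k) (A := H)).lTensor M (coact m)
  counital : ∀ m, TensorProduct.rid k M ((counit (R := k) (A := H)).lTensor M (coact m)) = m
  coact_smul : ∀ (m : M) (s : S),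
    coact (MulOpposite.op s • m) = tensorAct k H S M (coact m) (CS.coact s)

/-! ### The algebras `Hom_k(M, M ⊗ A)` and `Hom_S(M, M ⊗ A)` -/

/-- The `k`-module `Hom_k(M, M ⊗ A)`. For `A = H` and `A = H ⊗ H` this is `W_k^1(M)` and
`W_k^2(M)`; the algebra `W_k^0(M)` is `Module.End k M`. -/
def W (k M A : Type*) [CommRing k] [AddCommGroup M] [Module k M] [Ring A] [Algebra k A] : Type _ :=
  M →ₗ[k] M ⊗[k] A

namespace W

section Basic

variable {k M A B : Type*} [CommRing k] [AddCommGroup M] [Module k M] [Ring A] [Algebra k A]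
  [Ring B] [Algebra k B]

instance : AddCommGroup (W k M A) := inferInstanceAs (AddCommGroup (M →ₗ[k] M ⊗[k] A))
instance : Module k (W k M A) := inferInstanceAs (Module k (M →ₗ[k] M ⊗[k] A))
instance : FunLike (W k M A) M (M ⊗[k] A) := inferInstanceAs (FunLike (M →ₗ[k] M ⊗[k] A) _ _)
instance : LinearMapClass (W k M A) k M (M ⊗[k] A) :=
  inferInstanceAs (LinearMapClass (M →ₗ[k] M ⊗[k] A) k M (M ⊗[k] A))

@[ext]
theorem ext {Φ Ψ : W k M A} (h : ∀ m, Φ m = Ψ m) : Φ = Ψ := LinearMap.ext h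

/-- A linear map `M → M ⊗ A`, as an element of `W k M A`. -/
def ofLin (f : M →ₗ[k] M ⊗[k] A) : W k M A := f

theorem ofLin_apply (f : M →ₗ[k] M ⊗[k] A) (m : M) : ofLin f m = f m := rfl

/-- The underlying linear map. -/
def toLin (Φ : W k M A) : M →ₗ[k] M ⊗[k] A := Φ

@[simp]
theorem toLin_apply (Φ : W k M A) (m : M) : Φ.toLin m = Φ m := rfl

/-- The map `(id_M ⊗ μ_A) ∘ (Φ ⊗ id_A)`, that is, `m ⊗ a ↦ Φ(m) a`. -/
def extend (Φ : W k M A) : M ⊗[k] A →ₗ[k] M ⊗[k] A :=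
  (LinearMap.mul' k A).lTensor M ∘ₗ (TensorProduct.assoc k M A A).toLinearMap ∘ₗ
    LinearMap.rTensor A Φ.toLin

/-- The composition-type product `(id_M ⊗ μ_A) ∘ (Φ ⊗ id_A) ∘ Ψ`. -/
instance : Mul (W k M A) := ⟨fun Φ Ψ => ofLin (Φ.extend ∘ₗ Ψ.toLin)⟩

/-- The unit `m ↦ m ⊗ 1`. -/
instance : One (W k M A) := ⟨ofLin ((TensorProduct.mk k M A).flip 1)⟩

theorem mul_apply (Φ Ψ : W k M A) (m : M) : (Φ * Ψ) m = Φ.extend (Ψ m) := rfl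
theorem one_apply (m : M) : (1 : W k M A) m = m ⊗ₜ 1 := rfl
theorem add_apply (Φ Ψ : W k M A) (m : M) : (Φ + Ψ) m = Φ m + Ψ m := rfl
theorem zero_apply (m : M) : (0 : W k M A) m = 0 := rfl
theorem smul_apply (c : k) (Φ : W k M A) (m : M) : (c • Φ) m = c • Φ m := rfl

theorem extend_tmul (Φ : W k M A) (m : M) (a : A) :
    Φ.extend (m ⊗ₜ a) = (LinearMap.mulRight k a).lTensor M (Φ m) := by
  change (LinearMap.mul' k A).lTensor M (TensorProduct.assoc k M A A (Φ m ⊗ₜ a)) = _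
  induction Φ m with
  | zero => simp
  | tmul x y => simp
  | add x y hx hy => simp only [TensorProduct.add_tmul, map_add, hx, hy]

theorem extend_mulRight (Φ : W k M A) (a : A) (x : M ⊗[k] A) :
    Φ.extend ((LinearMap.mulRight k a).lTensor M x) =
      (LinearMap.mulRight k a).lTensor M (Φ.extend x) := by
  induction x with
  | zero => simp
  | tmul m b =>
    simp only [LinearMap.lTensor_tmul, LinearMap.mulRight_apply, extend_tmul]
    rw [LinearMap.mulRight_mul, LinearMap.lTensor_comp_apply]
  | add x y hx hy => simp only [map_add, hx, hy]

theorem extend_extend (Φ Ψ : W k M A) (x : M ⊗[k] A) :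
    (Φ * Ψ).extend x = Φ.extend (Ψ.extend x) := by
  induction x with
  | zero => simp
  | tmul m b => rw [extend_tmul, extend_tmul, mul_apply, extend_mulRight]
  | add x y hx hy => simp only [map_add, hx, hy]

theorem extend_one (x : M ⊗[k] A) : (1 : W k M A).extend x = x := by
  induction x with
  | zero => simp
  | tmul m b => rw [extend_tmul, one_apply]; simp
  | add x y hx hy => simp only [map_add, hx, hy]

theorem extend_add (Φ Ψ : W k M A) (x : M ⊗[k] A) :
    (Φ + Ψ).extend x = Φ.extend x + Ψ.extend x := by
  induction x with
  | zero => simp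
  | tmul m b => simp only [extend_tmul, add_apply, map_add]
  | add x y hx hy => simp only [map_add, hx, hy]; abel

theorem extend_smul (c : k) (Φ : W k M A) (x : M ⊗[k] A) :
    (c • Φ).extend x = c • Φ.extend x := by
  induction x with
  | zero => simp
  | tmul m b => simp only [extend_tmul, smul_apply, map_smul]
  | add x y hx hy => simp only [map_add, hx, hy, smul_add]

theorem extend_zero (x : M ⊗[k] A) : (0 : W k M A).extend x = 0 := by
  simpa using extend_smul (0 : k) (0 : W k M A) x

instance : Ring (W k M A) :=
  { (inferInstance : AddCommGroup (W k M A)), (inferInstance : Mul (W k M A)),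
    (inferInstance : One (W k M A)) with
    left_distrib := fun Φ Ψ Θ => by
      ext m; simp only [mul_apply, add_apply, map_add]
    right_distrib := fun Φ Ψ Θ => by
      ext m; simp only [mul_apply, add_apply, extend_add]
    zero_mul := fun Φ => by ext m; simp only [mul_apply, extend_zero, zero_apply]
    mul_zero := fun Φ => by ext m; simp only [mul_apply, zero_apply, map_zero]
    mul_assoc := fun Φ Ψ Θ => by ext m; simp only [mul_apply, extend_extend]
    one_mul := fun Φ => by ext m; simp only [mul_apply, extend_one]
    mul_one := fun Φ => by ext m; rw [mul_apply, one_apply, extend_tmul]; simp }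

instance : Algebra k (W k M A) :=
  Algebra.ofModule
    (fun c Φ Ψ => by ext m; simp only [mul_apply, smul_apply, extend_smul])
    (fun c Φ Ψ => by ext m; simp only [mul_apply, smul_apply, map_smul])

variable (k M A) in
/-- The algebra morphism `φ ↦ φ ⊗ η_A`, from `End_k(M)` to `Hom_k(M, M ⊗ A)`. -/
def const : Module.End k M →ₐ[k] W k M A :=
  AlgHom.ofLinearMap
    { toFun := fun φ => ofLin ((TensorProduct.mk k M A).flip 1 ∘ₗ φ)
      map_add' := fun φ ψ => by
        ext m
        exact TensorProduct.add_tmul _ _ _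
      map_smul' := fun c φ => by
        ext m
        exact (TensorProduct.smul_tmul' _ _ _).symm }
    rfl
    (fun φ ψ => by
      ext m
      change (φ (ψ m)) ⊗ₜ[k] (1 : A) =
        extend (ofLin ((TensorProduct.mk k M A).flip 1 ∘ₗ φ)) (ψ m ⊗ₜ[k] (1 : A))
      rw [extend_tmul]
      simp only [LinearMap.mulRight_one, LinearMap.lTensor_id]
      rfl)

theorem const_apply (φ : Module.End k M) (m : M) : const k M A φ m = φ m ⊗ₜ 1 := rfl

variable (M) in
/-- The algebra morphism `Φ ↦ (id_M ⊗ g) ∘ Φ` induced by an algebra morphism `g : A → B`. -/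
def map (g : A →ₐ[k] B) : W k M A →ₐ[k] W k M B :=
  AlgHom.ofLinearMap
    { toFun := fun Φ => ofLin (g.toLinearMap.lTensor M ∘ₗ Φ.toLin)
      map_add' := fun Φ Ψ => by
        ext m
        exact map_add (g.toLinearMap.lTensor M) (Φ m) (Ψ m)
      map_smul' := fun c Φ => by
        ext m
        exact map_smul (g.toLinearMap.lTensor M) c (Φ m) }
    (by
      ext m
      change g.toLinearMap.lTensor M (m ⊗ₜ 1) = m ⊗ₜ 1
      simp)
    (fun Φ Ψ => by
      ext m
      change g.toLinearMap.lTensor M (Φ.extend (Ψ m)) =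
        extend (ofLin (g.toLinearMap.lTensor M ∘ₗ Φ.toLin))
          (g.toLinearMap.lTensor M (Ψ m))
      induction Ψ m with
      | zero => simp
      | tmul x a =>
        rw [LinearMap.lTensor_tmul, extend_tmul, extend_tmul]
        change _ = (LinearMap.mulRight k (g a)).lTensor M (g.toLinearMap.lTensor M (Φ x))
        rw [← LinearMap.lTensor_comp_apply, ← LinearMap.lTensor_comp_apply]
        congr 2
        ext b
        simp
      | add x y hx hy => simp only [map_add, hx, hy])

theorem map_apply (g : A →ₐ[k] B) (Φ : W k M A) (m : M) :
    map M g Φ m = g.toLinearMap.lTensor M (Φ m) := rfl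

end Basic

section Linear

variable {k M A B S : Type*} [CommRing k] [AddCommGroup M] [Module k M] [Ring A] [Algebra k A]
  [Ring B] [Algebra k B] [Ring S] [Algebra k S] [Module Sᵐᵒᵖ M] [IsScalarTower k Sᵐᵒᵖ M]

variable (k S M) in
/-- The inclusion of `End_S(M)` into `End_k(M)`. -/
def endToEnd : Module.End Sᵐᵒᵖ M →ₐ[k] Module.End k M :=
  AlgHom.ofLinearMap
    { toFun := fun φ => φ.restrictScalars k
      map_add' := fun _ _ => rfl
      map_smul' := fun _ _ => rfl } rfl (fun _ _ => rfl)

theorem endToEnd_apply (φ : Module.End Sᵐᵒᵖ M) (m : M) : endToEnd k M S φ m = φ m := rfl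

/-- `rho x : m ↦ m x`, for `x ∈ S ⊗ A`, with `m (s ⊗ a) = m s ⊗ a`. -/
def rho (x : S ⊗[k] A) : W k M A :=
  ofLin ((tensorAct k A S M).flip x ∘ₗ (TensorProduct.mk k M A).flip 1)

theorem rho_apply (x : S ⊗[k] A) (m : M) : rho x m = tensorAct k A S M (m ⊗ₜ 1) x := rfl

theorem rho_tmul (s : S) (a : A) (m : M) :
    rho (k := k) (s ⊗ₜ a) m = (MulOpposite.op s • m) ⊗ₜ a := by
  simp [rho_apply]

theorem mulRight_smul (s : S) (a : A) (x : M ⊗[k] A) :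
    (LinearMap.mulRight k a).lTensor M (MulOpposite.op s • x) =
      MulOpposite.op s • (LinearMap.mulRight k a).lTensor M x := by
  induction x with
  | zero => simp
  | tmul m b => simp [TensorProduct.smul_tmul']
  | add x y hx hy => simp only [map_add, hx, hy, smul_add]

theorem rho_mul_apply (s : S) (Φ : W k M A) (m : M) :
    (rho (s ⊗ₜ 1) * Φ : W k M A) m = MulOpposite.op s • Φ m := by
  rw [mul_apply]
  induction Φ m with
  | zero => simp
  | tmul x a => rw [extend_tmul, rho_tmul]; simp [TensorProduct.smul_tmul']
  | add x y hx hy => simp only [map_add, hx, hy, smul_add]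

theorem mul_rho_apply (Φ : W k M A) (s : S) (a : A) (m : M) :
    (Φ * rho (s ⊗ₜ a) : W k M A) m =
      (LinearMap.mulRight k a).lTensor M (Φ (MulOpposite.op s • m)) := by
  rw [mul_apply, rho_tmul, extend_tmul]

theorem linear_iff (Φ : W k M A) :
    (∀ (s : S) (m : M), Φ (MulOpposite.op s • m) = MulOpposite.op s • Φ m) ↔
      ∀ s : S, rho (s ⊗ₜ 1) * Φ = Φ * rho (s ⊗ₜ 1) := by
  constructor
  · intro h s
    ext m
    rw [rho_mul_apply, mul_rho_apply, h]
    simp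
  · intro h s m
    have := congrArg (fun Θ : W k M A => Θ m) (h s)
    simp only [rho_mul_apply, mul_rho_apply] at this
    simpa using this.symm

variable (k M A S) in
/-- The subalgebra `Hom_S(M, M ⊗ A)` of `Hom_k(M, M ⊗ A)`, for the right `S`-module structure
`(m ⊗ a) s = m s ⊗ a` on `M ⊗ A`. -/
def linear : Subalgebra k (W k M A) where
  carrier := {Φ | ∀ (s : S) (m : M), Φ (MulOpposite.op s • m) = MulOpposite.op s • Φ m}
  mul_mem' {Φ Ψ} hΦ hΨ := by
    rw [Set.mem_ofPred_eq, linear_iff] at *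
    intro s
    rw [← mul_assoc, hΦ, mul_assoc, hΨ, mul_assoc]
  add_mem' {Φ Ψ} hΦ hΨ := fun s m => by
    rw [add_apply, add_apply, hΦ, hΨ, smul_add]
  algebraMap_mem' c := by
    rw [Set.mem_ofPred_eq, linear_iff]
    intro s
    exact (Algebra.commutes _ _).symm

theorem mem_linear (Φ : W k M A) : Φ ∈ linear k M A S ↔
    ∀ (s : S) (m : M), Φ (MulOpposite.op s • m) = MulOpposite.op s • Φ m := Iff.rfl

theorem const_mem (φ : Module.End Sᵐᵒᵖ M) : const k M A (endToEnd k M S φ) ∈ linear k M A S := by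
  intro s m
  simp only [const_apply, endToEnd_apply, map_smul, TensorProduct.smul_tmul']

theorem map_mem (g : A →ₐ[k] B) {Φ : W k M A} (h : Φ ∈ linear k M A S) :
    map M g Φ ∈ linear k M B S := by
  intro s m
  rw [map_apply, map_apply, h]
  induction Φ m with
  | zero => simp
  | tmul x a => simp [TensorProduct.smul_tmul']
  | add x y hx hy => simp only [map_add, hx, hy, smul_add]

variable (k M A S) in
/-- The algebra morphism `A → Hom_S(M, M ⊗ A)` sending `a` to `m ↦ m ⊗ a`. -/
def scalar : A →ₐ[k] linear k M A S :=
  AlgHom.codRestrict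
    (AlgHom.ofLinearMap
      { toFun := fun a => ofLin ((TensorProduct.mk k M A).flip a)
        map_add' := fun a b => by
          ext m
          exact TensorProduct.tmul_add _ _ _
        map_smul' := fun c a => by
          ext m
          exact TensorProduct.tmul_smul _ _ _ }
      rfl
      (fun a b => by
        apply W.ext
        intro m
        change m ⊗ₜ[k] (a * b) = extend
          (ofLin ((TensorProduct.mk k M A).flip a)) (m ⊗ₜ[k] b)
        rw [extend_tmul]
        rfl) : A →ₐ[k] W k M A)
    (linear k M A S)
    (fun _ _ _ => (TensorProduct.smul_tmul' _ _ _).symm)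

theorem scalar_apply (a : A) (m : M) : (scalar k M A S a : W k M A) m = m ⊗ₜ a := rfl

variable (k M A S) in
/-- The algebra morphism `End_S(M) → Hom_S(M, M ⊗ A)` sending `f` to `m ↦ f(m) ⊗ 1`. -/
def constS : Module.End Sᵐᵒᵖ M →ₐ[k] linear k M A S :=
  ((const k M A).comp (endToEnd k M S)).codRestrict (linear k M A S)
    (by intro φ; rw [AlgHom.comp_apply]; exact const_mem φ)

theorem constS_apply (f : Module.End Sᵐᵒᵖ M) (m : M) :
    (constS k M A S f : W k M A) m = f m ⊗ₜ 1 := rfl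

theorem constS_comm_scalar (f : Module.End Sᵐᵒᵖ M) (a : A) :
    Commute (constS k M A S f) (scalar k M A S a) := by
  apply Subtype.ext
  apply W.ext
  intro m
  change extend (constS k M A S f : W k M A) ((scalar k M A S a : W k M A) m) =
    extend (scalar k M A S a : W k M A) ((constS k M A S f : W k M A) m)
  rw [scalar_apply, constS_apply, extend_tmul, extend_tmul, scalar_apply, constS_apply]
  simp

variable (k M A S) in
/-- The algebra morphism `End_S(M) ⊗ A → Hom_S(M, M ⊗ A)` given by
`ω(f ⊗ a)(m) = f(m) ⊗ a`. For `A = H` it is `ω₁`, for `A = H ⊗ H` it is `ω₂`. -/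
def omega : Module.End Sᵐᵒᵖ M ⊗[k] A →ₐ[k] linear k M A S :=
  Algebra.TensorProduct.lift
    (constS k M A S) (scalar k M A S)
    constS_comm_scalar

@[simp]
theorem omega_tmul (f : Module.End Sᵐᵒᵖ M) (a : A) (m : M) :
    (omega k M A S (f ⊗ₜ a) : W k M A) m = f m ⊗ₜ a := by
  rw [omega, Algebra.TensorProduct.lift_tmul]
  change extend (constS k M A S f : W k M A) ((scalar k M A S a : W k M A) m) = _
  rw [scalar_apply, extend_tmul, constS_apply]
  simp

variable (k M A S) in
/-- The condition that `ω : End_S(M) ⊗ A → Hom_S(M, M ⊗ A)` is an isomorphism of algebras. For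
`A = H` and `A = H ⊗ H` these are the conditions `𝓕₁` and `𝓕₂`. (For `n = 0` the map `ω₀` is the
identity of `End_S(M)`, so that the condition `𝓕₀` always holds.) -/
def ConditionF : Prop := Function.Bijective (omega k M A S)

end Linear

end W

/-! ### The coface maps `bⁱ` and restricted non-abelian Hopf cohomology -/

section Antipode

variable {k M H : Type*} [CommRing k] [AddCommGroup M] [Module k M] [Ring H] [HopfAlgebra k H]

theorem sweedler_right (δ : M →ₗ[k] M ⊗[k] H)
    (coassoc : ∀ m, TensorProduct.assoc k M H H (δ.rTensor H (δ m)) =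
      (comul (R := k) (A := H)).lTensor M (δ m))
    (counital : ∀ m, TensorProduct.rid k M ((counit (R := k) (A := H)).lTensor M (δ m)) = m)
    (m : M) : (LinearMap.mul' k H ∘ₗ (antipode k).lTensor H).lTensor M
      (TensorProduct.assoc k M H H (δ.rTensor H (δ m))) = m ⊗ₜ 1 := by
  rw [coassoc, ← LinearMap.lTensor_comp_apply, LinearMap.comp_assoc,
    HopfAlgebra.mul_antipode_lTensor_comul, LinearMap.lTensor_comp_apply]
  have : (counit (R := k) (A := H)).lTensor M (δ m) = m ⊗ₜ 1 := by
    apply (TensorProduct.rid k M).injective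
    rw [counital]; simp
  rw [this]; simp

theorem sweedler_left (δ : M →ₗ[k] M ⊗[k] H)
    (coassoc : ∀ m, TensorProduct.assoc k M H H (δ.rTensor H (δ m)) =
      (comul (R := k) (A := H)).lTensor M (δ m))
    (counital : ∀ m, TensorProduct.rid k M ((counit (R := k) (A := H)).lTensor M (δ m)) = m)
    (m : M) : (LinearMap.mul' k H ∘ₗ (antipode k).rTensor H).lTensor M
      (TensorProduct.assoc k M H H (δ.rTensor H (δ m))) = m ⊗ₜ 1 := by
  rw [coassoc, ← LinearMap.lTensor_comp_apply, LinearMap.comp_assoc,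
    HopfAlgebra.mul_antipode_rTensor_comul, LinearMap.lTensor_comp_apply]
  have : (counit (R := k) (A := H)).lTensor M (δ m) = m ⊗ₜ 1 := by
    apply (TensorProduct.rid k M).injective
    rw [counital]; simp
  rw [this]; simp

end Antipode

namespace HopfModule

variable {k H S : Type*} [CommRing k] [Ring H] [HopfAlgebra k H] [Ring S] [Algebra k S]
  {CS : ComoduleAlgebra k H S} {M : Type*} [AddCommGroup M] [Module k M] [Module Sᵐᵒᵖ M]
  [IsScalarTower k Sᵐᵒᵖ M]

/-- `b⁰ φ = (id_M ⊗ μ_H) ∘ (Δ_M ⊗ id_H) ∘ (φ ⊗ σ_H) ∘ Δ_M` for `φ ∈ End_k(M)`. -/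
def b0Fun (HM : HopfModule CS M) (φ : Module.End k M) : W k M H :=
  W.ofLin ((LinearMap.mul' k H).lTensor M ∘ₗ (TensorProduct.assoc k M H H).toLinearMap ∘ₗ
    HM.coact.rTensor H ∘ₗ TensorProduct.map φ (antipode k) ∘ₗ HM.coact)

/-- `b⁰ Φ = (id_M ⊗ μ_H ⊗ id_H) ∘ (Δ_M ⊗ T) ∘ (Φ ⊗ σ_H) ∘ Δ_M` for `Φ ∈ Hom_k(M, M ⊗ H)`, where
`T` is the flip of `H ⊗ H`. -/
def bb0Fun (HM : HopfModule CS M) (Φ : W k M H) : W k M (H ⊗[k] H) :=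
  W.ofLin (((LinearMap.mul' k H).rTensor H ∘ₗ
      (TensorProduct.assoc k H H H).symm.toLinearMap).lTensor M ∘ₗ
    (TensorProduct.assoc k M H (H ⊗[k] H)).toLinearMap ∘ₗ
    TensorProduct.map HM.coact (TensorProduct.comm k H H).toLinearMap ∘ₗ
    (TensorProduct.assoc k M H H).toLinearMap ∘ₗ
    TensorProduct.map Φ.toLin (antipode k) ∘ₗ HM.coact)

/-- The coaction `Δ_M`, as an element of the algebra `Hom_k(M, M ⊗ H)`. -/
def cW (HM : HopfModule CS M) : W k M H := W.ofLin HM.coact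

/-- The map `(id_M ⊗ σ_H) ∘ Δ_M`. -/
def cWinv (HM : HopfModule CS M) : W k M H :=
  W.ofLin ((antipode k).lTensor M ∘ₗ HM.coact)

theorem cW_apply (HM : HopfModule CS M) (m : M) : HM.cW m = HM.coact m := rfl

theorem cWinv_apply (HM : HopfModule CS M) (m : M) :
    HM.cWinv m = (antipode k).lTensor M (HM.coact m) := rfl

theorem cW_mul_cWinv (HM : HopfModule CS M) : HM.cW * HM.cWinv = 1 := by
  ext m
  rw [W.one_apply, ← sweedler_right HM.coact HM.coassoc HM.counital m]
  change HM.cW.extend ((antipode k).lTensor M (HM.coact m)) = _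
  induction HM.coact m with
  | zero => simp
  | tmul x h =>
    rw [LinearMap.lTensor_tmul, W.extend_tmul, LinearMap.rTensor_tmul, cW_apply]
    induction HM.coact x with
    | zero => simp
    | tmul y g => simp
    | add x y hx hy => simp only [map_add, hx, hy, TensorProduct.add_tmul]
  | add x y hx hy => simp only [map_add, hx, hy]

theorem cWinv_mul_cW (HM : HopfModule CS M) : HM.cWinv * HM.cW = 1 := by
  ext m
  rw [W.one_apply, ← sweedler_left HM.coact HM.coassoc HM.counital m]
  change HM.cWinv.extend (HM.coact m) = _
  induction HM.coact m with
  | zero => simp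
  | tmul x h =>
    rw [W.extend_tmul, LinearMap.rTensor_tmul, cWinv_apply]
    induction HM.coact x with
    | zero => simp
    | tmul y g => simp
    | add x y hx hy => simp only [map_add, hx, hy, TensorProduct.add_tmul]
  | add x y hx hy => simp only [map_add, hx, hy]

theorem b0Fun_eq (HM : HopfModule CS M) (φ : Module.End k M) :
    HM.b0Fun φ = HM.cW * W.const k M H φ * HM.cWinv := by
  ext m
  rw [mul_assoc, W.mul_apply, W.mul_apply]
  change HM.cW.extend (TensorProduct.map φ (antipode k) (HM.coact m)) =
    HM.cW.extend ((W.const k M H φ).extend ((antipode k).lTensor M (HM.coact m)))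
  congr 1
  induction HM.coact m with
  | zero => simp
  | tmul x h => rw [LinearMap.lTensor_tmul, W.extend_tmul, W.const_apply]; simp
  | add x y hx hy => simp only [map_add, hx, hy]

variable (k H) in
/-- `h ↦ h ⊗ 1`. -/
abbrev inl : H →ₐ[k] H ⊗[k] H := Algebra.TensorProduct.includeLeft

variable (k H) in
/-- `h ↦ 1 ⊗ h`. -/
abbrev inr : H →ₐ[k] H ⊗[k] H := Algebra.TensorProduct.includeRight

theorem bb0Fun_eq (HM : HopfModule CS M) (Φ : W k M H) :
    HM.bb0Fun Φ = W.map M (inl k H) HM.cW * W.map M (inr k H) Φ * W.map M (inl k H) HM.cWinv := by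
  ext m
  rw [mul_assoc, W.mul_apply, W.mul_apply, W.map_apply]
  change (((LinearMap.mul' k H).rTensor H ∘ₗ
      (TensorProduct.assoc k H H H).symm.toLinearMap).lTensor M)
      (TensorProduct.assoc k M H (H ⊗[k] H)
        (TensorProduct.map HM.coact (TensorProduct.comm k H H).toLinearMap
          (TensorProduct.assoc k M H H
            (TensorProduct.map Φ.toLin (antipode k) (HM.coact m))))) =
    W.extend _ (W.extend _ ((inl k H).toLinearMap.lTensor M
      ((antipode k).lTensor M (HM.coact m))))
  induction HM.coact m with
  | zero => simp
  | tmul x h =>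
    rw [LinearMap.lTensor_tmul, LinearMap.lTensor_tmul, W.extend_tmul, W.map_apply,
      TensorProduct.map_tmul, W.toLin_apply]
    induction Φ x with
    | zero => simp
    | tmul y g =>
      simp only [LinearMap.lTensor_tmul, W.extend_tmul, W.map_apply, TensorProduct.assoc_tmul,
        TensorProduct.map_tmul, cW_apply]
      induction HM.coact y with
      | zero => simp
      | tmul z f => simp
      | add x y hx hy => simp only [map_add, hx, hy, TensorProduct.add_tmul]
    | add x y hx hy => simp only [map_add, hx, hy, TensorProduct.add_tmul]
  | add x y hx hy => simp only [map_add, hx, hy]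

theorem inl_cW_mul (HM : HopfModule CS M) :
    W.map M (inl k H) HM.cW * W.map M (inl k H) HM.cWinv = 1 := by
  rw [← map_mul, cW_mul_cWinv, map_one]

theorem inl_cWinv_mul (HM : HopfModule CS M) :
    W.map M (inl k H) HM.cWinv * W.map M (inl k H) HM.cW = 1 := by
  rw [← map_mul, cWinv_mul_cW, map_one]

/-- Conjugation `a ↦ u a v` as an algebra morphism, where `v` is the inverse of `u`. -/
def conj {k R : Type*} [CommRing k] [Ring R] [Algebra k R] (u v : R) (h : u * v = 1)
    (h' : v * u = 1) : R →ₐ[k] R :=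
  AlgHom.ofLinearMap ((LinearMap.mulRight k v) ∘ₗ (LinearMap.mulLeft k u)) (by simp [h])
    (fun x y => by
      simp only [LinearMap.comp_apply, LinearMap.mulLeft_apply, LinearMap.mulRight_apply]
      rw [show u * x * v * (u * y * v) = u * x * (v * u) * y * v by simp only [mul_assoc], h']
      simp only [mul_assoc, mul_one])

/-- Replace the underlying function of an algebra morphism by an equal one. -/
def copyHom {k R R' : Type*} [CommRing k] [Ring R] [Algebra k R] [Ring R'] [Algebra k R']
    (f : R →ₐ[k] R') (g : R → R') (h : ∀ x, g x = f x) : R →ₐ[k] R' where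
  toFun := g
  map_one' := by rw [h, map_one]
  map_mul' x y := by rw [h, h, h, map_mul]
  map_zero' := by rw [h, map_zero]
  map_add' x y := by rw [h, h, h, map_add]
  commutes' c := by rw [h, AlgHom.commutes]

/-- The algebra morphism `b⁰ : W_k^0(M) → W_k^1(M)`. -/
def b0 (HM : HopfModule CS M) : Module.End k M →ₐ[k] W k M H :=
  copyHom ((conj HM.cW HM.cWinv HM.cW_mul_cWinv HM.cWinv_mul_cW).comp (W.const k M H)) HM.b0Fun
    HM.b0Fun_eq

/-- The algebra morphism `b¹ : W_k^0(M) → W_k^1(M)`, `b¹ φ = (id_M ⊗ η_H) ∘ φ`. -/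
def b1 (_HM : HopfModule CS M) : Module.End k M →ₐ[k] W k M H := W.const k M H

/-- The algebra morphism `b⁰ : W_k^1(M) → W_k^2(M)`. -/
def bb0 (HM : HopfModule CS M) : W k M H →ₐ[k] W k M (H ⊗[k] H) :=
  copyHom ((conj _ _ HM.inl_cW_mul HM.inl_cWinv_mul).comp (W.map M (inr k H))) HM.bb0Fun
    HM.bb0Fun_eq

/-- The algebra morphism `b¹ : W_k^1(M) → W_k^2(M)`, `b¹ Φ = (id_M ⊗ Δ_H) ∘ Φ`. -/
def bb1 (_HM : HopfModule CS M) : W k M H →ₐ[k] W k M (H ⊗[k] H) :=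
  W.map M (Bialgebra.comulAlgHom k H)

/-- The algebra morphism `b² : W_k^1(M) → W_k^2(M)`, `b² Φ = (id_M ⊗ id_H ⊗ η_H) ∘ Φ`. -/
def bb2 (_HM : HopfModule CS M) : W k M H →ₐ[k] W k M (H ⊗[k] H) := W.map M (inl k H)

theorem b0_eq (HM : HopfModule CS M) (φ : Module.End k M) :
    HM.b0 φ = HM.cW * W.const k M H φ * HM.cWinv := HM.b0Fun_eq φ

theorem bb0_eq (HM : HopfModule CS M) (Φ : W k M H) :
    HM.bb0 Φ = W.map M (inl k H) HM.cW * W.map M (inr k H) Φ * W.map M (inl k H) HM.cWinv :=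
  HM.bb0Fun_eq Φ

/-! The pre-cosimplicial relations. -/

theorem map_const {A B : Type*} [Ring A] [Algebra k A] [Ring B] [Algebra k B] (g : A →ₐ[k] B)
    (φ : Module.End k M) : W.map M g (W.const k M A φ) = W.const k M B φ := by
  ext m
  rw [W.map_apply, W.const_apply, W.const_apply]
  simp

theorem inl_mul_inr_cW (HM : HopfModule CS M) :
    W.map M (inl k H) HM.cW * W.map M (inr k H) HM.cW =
      W.map M (Bialgebra.comulAlgHom k H) HM.cW := by
  ext m
  rw [W.mul_apply, W.map_apply, W.map_apply]
  refine Eq.trans ?_ (HM.coassoc m)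
  change W.extend _ ((inr k H).toLinearMap.lTensor M (HM.coact m)) = _
  induction HM.coact m with
  | zero => simp
  | tmul x h =>
    rw [LinearMap.lTensor_tmul, W.extend_tmul, W.map_apply, LinearMap.rTensor_tmul, cW_apply]
    induction HM.coact x with
    | zero => simp
    | tmul z f => simp
    | add x y hx hy => simp only [map_add, hx, hy, TensorProduct.add_tmul]
  | add x y hx hy => simp only [map_add, hx, hy]

theorem inr_mul_inl_cWinv (HM : HopfModule CS M) :
    W.map M (inr k H) HM.cWinv * W.map M (inl k H) HM.cWinv =
      W.map M (Bialgebra.comulAlgHom k H) HM.cWinv := by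
  have h1 : W.map M (Bialgebra.comulAlgHom k H) HM.cWinv *
      W.map M (Bialgebra.comulAlgHom k H) HM.cW = 1 := by
    rw [← map_mul, cWinv_mul_cW, map_one]
  have h2 : W.map M (Bialgebra.comulAlgHom k H) HM.cW *
      (W.map M (inr k H) HM.cWinv * W.map M (inl k H) HM.cWinv) = 1 := by
    rw [← inl_mul_inr_cW, mul_assoc, ← mul_assoc (W.map M (inr k H) HM.cW), ← map_mul,
      cW_mul_cWinv, map_one, one_mul, inl_cW_mul]
  exact (left_inv_eq_right_inv h1 h2).symm

theorem bb1_b0 (HM : HopfModule CS M) (φ : Module.End k M) :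
    HM.bb1 (HM.b0 φ) = HM.bb0 (HM.b0 φ) := by
  rw [bb0_eq, b0_eq, bb1, map_mul, map_mul, map_mul, map_mul, ← inl_mul_inr_cW,
    ← inr_mul_inl_cWinv, map_const, map_const]
  simp only [mul_assoc]

theorem bb2_b0 (HM : HopfModule CS M) (φ : Module.End k M) :
    HM.bb2 (HM.b0 φ) = HM.bb0 (HM.b1 φ) := by
  rw [bb0_eq, b0_eq, bb2, b1, map_mul, map_mul, map_const, map_const]

theorem bb2_b1 (HM : HopfModule CS M) (φ : Module.End k M) :
    HM.bb2 (HM.b1 φ) = HM.bb1 (HM.b1 φ) := by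
  rw [bb1, bb2, b1, map_const, map_const]

/-! The maps `bⁱ` preserve `S`-linearity. -/

theorem rho_mul_cW (HM : HopfModule CS M) (s : S) :
    (W.rho (s ⊗ₜ 1) * HM.cW : W k M H) =
      HM.cW * W.rho ((antipode k).lTensor S (CS.coact s)) := by
  ext m
  rw [W.mul_apply, W.mul_apply, W.rho_apply]
  have h1 : ∀ x : M ⊗[k] H, W.extend (W.rho (k := k) (M := M) (A := H) (s ⊗ₜ 1)) x =
      tensorAct k H S M x (s ⊗ₜ 1) := by
    intro x
    induction x with
    | zero => simp
    | tmul y h => rw [W.extend_tmul, W.rho_tmul]; simp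
    | add x y hx hy => simp only [map_add, hx, hy, LinearMap.add_apply]
  have h2 : ∀ y : S ⊗[k] H, HM.cW.extend (tensorAct k H S M (m ⊗ₜ 1) ((antipode k).lTensor S y)) =
      tensorAct k H S M (HM.coact m) ((LinearMap.mul' k H ∘ₗ (antipode k).lTensor H).lTensor S
      (TensorProduct.assoc k S H H (CS.coact.toLinearMap.rTensor H y))) := by
    intro y
    induction y with
    | zero => simp
    | tmul t h =>
      rw [LinearMap.lTensor_tmul, tensorAct_tmul, one_mul, W.extend_tmul, LinearMap.rTensor_tmul,
        cW_apply, HM.coact_smul, AlgHom.toLinearMap_apply]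
      induction CS.coact t with
      | zero => simp
      | tmul t g =>
        induction HM.coact m with
        | zero => simp
        | tmul y f => simp [mul_assoc]
        | add x y hx hy => simp only [map_add, hx, hy, LinearMap.add_apply]
      | add x y hx hy => simp only [map_add, hx, hy, TensorProduct.add_tmul]
    | add x y hx hy => simp only [map_add, hx, hy]
  rw [h1, h2]
  have := sweedler_right CS.coact.toLinearMap CS.coassoc CS.counital s
  rw [AlgHom.toLinearMap_apply] at this
  rw [this]
  rfl

theorem cWinv_mul_rho (HM : HopfModule CS M) (s : S) :
    (HM.cWinv * W.rho (s ⊗ₜ 1) : W k M H) =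
      W.rho ((antipode k).lTensor S (CS.coact s)) * HM.cWinv := by
  have := congrArg (fun x => HM.cWinv * x * HM.cWinv) (HM.rho_mul_cW s)
  beta_reduce at this
  rw [mul_assoc, mul_assoc, cW_mul_cWinv, mul_one, ← mul_assoc HM.cWinv HM.cW, cWinv_mul_cW,
    one_mul] at this
  exact this

theorem map_rho {A B : Type*} [Ring A] [Algebra k A] [Ring B] [Algebra k B] (g : A →ₐ[k] B)
    (x : S ⊗[k] A) : W.map M g (W.rho x) = W.rho (g.toLinearMap.lTensor S x) := by
  ext m
  rw [W.map_apply, W.rho_apply, W.rho_apply]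
  induction x with
  | zero => simp
  | tmul s a => simp
  | add x y hx hy => simp only [map_add, hx, hy]

theorem const_comm_rho (φ : Module.End Sᵐᵒᵖ M) (x : S ⊗[k] H) :
    W.const k M H (W.endToEnd k M S φ) * W.rho x =
      W.rho x * W.const k M H (W.endToEnd k M S φ) := by
  ext m
  rw [W.mul_apply, W.mul_apply, W.const_apply, W.extend_tmul, W.rho_apply, W.rho_apply]
  induction x with
  | zero => simp
  | tmul s a =>
    rw [tensorAct_tmul, tensorAct_tmul, W.extend_tmul, W.const_apply]
    simp [W.endToEnd_apply]
  | add x y hx hy => simp only [map_add, hx, hy]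

theorem inr_comm_rho {Φ : W k M H} (hΦ : Φ ∈ W.linear k M H S) (x : S ⊗[k] H) :
    W.map M (inr k H) Φ * W.map M (inl k H) (W.rho x) =
      W.map M (inl k H) (W.rho x) * W.map M (inr k H) Φ := by
  rw [map_rho]
  ext m
  rw [W.mul_apply, W.mul_apply, W.rho_apply, W.map_apply]
  induction x with
  | zero =>
    simp only [map_zero]
    induction Φ m with
    | zero => simp
    | tmul y a => rw [LinearMap.lTensor_tmul, W.extend_tmul, W.rho_apply]; simp
    | add x y hx hy => rw [map_add, map_add, ← hx, ← hy, add_zero]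
  | tmul s a =>
    rw [LinearMap.lTensor_tmul, tensorAct_tmul, W.extend_tmul, W.map_apply, hΦ]
    induction Φ m with
    | zero => simp
    | tmul y b =>
      rw [LinearMap.lTensor_tmul, W.extend_tmul, W.rho_tmul]
      simp [TensorProduct.smul_tmul']
    | add x y hx hy => simp only [smul_add, map_add, hx, hy]
  | add x y hx hy =>
    have h3 : ∀ (x y : S ⊗[k] (H ⊗[k] H)) (z : M ⊗[k] (H ⊗[k] H)),
        W.extend (W.rho (x + y)) z = W.extend (W.rho x) z + W.extend (W.rho y) z := by
      intro x y z
      have h4 : (W.rho (x + y) : W k M (H ⊗[k] H)) = W.rho x + W.rho y := by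
        apply W.ext
        intro m
        rw [W.add_apply, W.rho_apply, W.rho_apply, W.rho_apply, map_add]
      rw [h4, W.extend_add]
    simp only [map_add, hx, hy, h3]

theorem b0_mem (HM : HopfModule CS M) (φ : Module.End Sᵐᵒᵖ M) :
    HM.b0 (W.endToEnd k M S φ) ∈ W.linear k M H S := by
  rw [W.mem_linear, W.linear_iff]
  intro s
  rw [b0_eq, mul_assoc _ _ (W.rho _), cWinv_mul_rho, ← mul_assoc, ← mul_assoc, rho_mul_cW,
    mul_assoc HM.cW, ← const_comm_rho]
  simp only [mul_assoc]

theorem bb0_mem (HM : HopfModule CS M) {Φ : W k M H} (hΦ : Φ ∈ W.linear k M H S) :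
    HM.bb0 Φ ∈ W.linear k M (H ⊗[k] H) S := by
  rw [W.mem_linear, W.linear_iff]
  intro s
  have h : (W.rho (s ⊗ₜ 1) : W k M (H ⊗[k] H)) = W.map M (inl k H) (W.rho (s ⊗ₜ 1)) := by
    rw [map_rho, LinearMap.lTensor_tmul, AlgHom.toLinearMap_apply, map_one]
  rw [bb0_eq, h, mul_assoc _ _ (W.map M (inl k H) (W.rho _)), ← map_mul, cWinv_mul_rho, map_mul,
    ← mul_assoc, ← mul_assoc, ← map_mul, rho_mul_cW, map_mul, mul_assoc (W.map M _ HM.cW),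
    ← inr_comm_rho hΦ]
  simp only [mul_assoc]

/-- The restriction of `b⁰` to `W_S^0(M) = End_S(M) → W_S^1(M)`. -/
def b0S (HM : HopfModule CS M) : Module.End Sᵐᵒᵖ M →ₐ[k] W.linear k M H S :=
  (HM.b0.comp (W.endToEnd k M S)).codRestrict _ HM.b0_mem

/-- The restriction of `b¹` to `W_S^0(M) = End_S(M) → W_S^1(M)`. -/
def b1S (HM : HopfModule CS M) : Module.End Sᵐᵒᵖ M →ₐ[k] W.linear k M H S :=
  (HM.b1.comp (W.endToEnd k M S)).codRestrict _ W.const_mem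

/-- The restriction of `b⁰` to `W_S^1(M) → W_S^2(M)`. -/
def bb0S (HM : HopfModule CS M) : W.linear k M H S →ₐ[k] W.linear k M (H ⊗[k] H) S :=
  (HM.bb0.comp (W.linear k M H S).val).codRestrict _ (fun Φ => HM.bb0_mem Φ.2)

/-- The restriction of `b¹` to `W_S^1(M) → W_S^2(M)`. -/
def bb1S (HM : HopfModule CS M) : W.linear k M H S →ₐ[k] W.linear k M (H ⊗[k] H) S :=
  (HM.bb1.comp (W.linear k M H S).val).codRestrict _ (fun Φ => W.map_mem _ Φ.2)

/-- The restriction of `b²` to `W_S^1(M) → W_S^2(M)`. -/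
def bb2S (HM : HopfModule CS M) : W.linear k M H S →ₐ[k] W.linear k M (H ⊗[k] H) S :=
  (HM.bb2.comp (W.linear k M H S).val).codRestrict _ (fun Φ => W.map_mem _ Φ.2)

/-- The pre-cosimplicial group `W_S^0(M)ˣ ⇉ W_S^1(M)ˣ ⇶ W_S^2(M)ˣ`. -/
def unitsDiagram (HM : HopfModule CS M) :
    PreCosimplicialGroup (Module.End Sᵐᵒᵖ M)ˣ (W.linear k M H S)ˣ
      (W.linear k M (H ⊗[k] H) S)ˣ where
  c0 := Units.map (HM.b0S : Module.End Sᵐᵒᵖ M →* W.linear k M H S)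
  c1 := Units.map (HM.b1S : Module.End Sᵐᵒᵖ M →* W.linear k M H S)
  d0 := Units.map (HM.bb0S : W.linear k M H S →* W.linear k M (H ⊗[k] H) S)
  d1 := Units.map (HM.bb1S : W.linear k M H S →* W.linear k M (H ⊗[k] H) S)
  d2 := Units.map (HM.bb2S : W.linear k M H S →* W.linear k M (H ⊗[k] H) S)
  d1_c0 _ := Units.ext (Subtype.ext (HM.bb1_b0 _))
  d2_c0 _ := Units.ext (Subtype.ext (HM.bb2_b0 _))
  d2_c1 _ := Units.ext (Subtype.ext (HM.bb2_b1 _))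

/-- The composite `Aut_S(M) → End_k(M)`, where `Aut_S(M)` is the group of invertible elements of
`End_S(M)`. -/
def autToEnd (_HM : HopfModule CS M) : (Module.End Sᵐᵒᵖ M)ˣ →* Module.End k M :=
  (W.endToEnd k M S : Module.End Sᵐᵒᵖ M →* Module.End k M).comp (Units.coeHom _)

/-- The restricted non-abelian `0`-cohomology group
`H⁰(H, M) = {φ ∈ Aut_S(M) | b¹ φ = b⁰ φ}`. -/
def resH0 (HM : HopfModule CS M) : Subgroup (Module.End Sᵐᵒᵖ M)ˣ :=
  MonoidHom.eqLocus ((HM.b1 : Module.End k M →* W k M H).comp HM.autToEnd)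
    ((HM.b0 : Module.End k M →* W k M H).comp HM.autToEnd)

/-- The set `Z¹(H, M)` of restricted Hopf `1`-cocycles: the `Φ ∈ Hom_k(M, M ⊗ H)` such that
`Φ(m s) = Φ(m) s`, `(id_M ⊗ ε_H) ∘ Φ = id_M`, and `b² Φ · b⁰ Φ = b¹ Φ`. -/
def resZ1 (HM : HopfModule CS M) : Set (W k M H) :=
  {Φ | (∀ (m : M) (s : S), Φ (MulOpposite.op s • m) = MulOpposite.op s • Φ m) ∧
    (∀ m : M, TensorProduct.rid k M ((counit (R := k) (A := H)).lTensor M (Φ m)) = m) ∧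
    HM.bb2 Φ * HM.bb0 Φ = HM.bb1 Φ}

/-- Two restricted `1`-cocycles are cohomologous if they lie in the same orbit of the right action
`Φ ↼ f = b¹ f⁻¹ · Φ · b⁰ f` of `Aut_S(M)`. -/
def resCohomologous (HM : HopfModule CS M) : Setoid HM.resZ1 where
  r Φ Ψ := ∃ f : (Module.End Sᵐᵒᵖ M)ˣ,
    (Ψ : W k M H) = HM.b1 (HM.autToEnd f⁻¹) * Φ * HM.b0 (HM.autToEnd f)
  iseqv :=
    { refl := fun Φ => ⟨1, by simp⟩
      symm := by
        rintro Φ Ψ ⟨f, h⟩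
        refine ⟨f⁻¹, ?_⟩
        have h1 : HM.b1 (HM.autToEnd f) * HM.b1 (HM.autToEnd f⁻¹) = 1 := by
          rw [← map_mul, ← map_mul, mul_inv_cancel, map_one, map_one]
        have h0 : HM.b0 (HM.autToEnd f) * HM.b0 (HM.autToEnd f⁻¹) = 1 := by
          rw [← map_mul, ← map_mul, mul_inv_cancel, map_one, map_one]
        rw [h, inv_inv, mul_assoc, mul_assoc, h0, mul_one, ← mul_assoc, h1, one_mul]
      trans := by
        rintro Φ Ψ Θ ⟨f, h⟩ ⟨g, h'⟩
        refine ⟨f * g, ?_⟩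
        rw [h', h, mul_inv_rev]
        simp only [map_mul, mul_assoc] }

/-- The restricted non-abelian `1`-cohomology set `H¹(H, M) = Aut_S(M) \ Z¹(H, M)`. -/
def resH1 (HM : HopfModule CS M) : Type _ := Quotient HM.resCohomologous

/-- The class of a restricted `1`-cocycle. -/
def resH1.mk (HM : HopfModule CS M) (Φ : HM.resZ1) : HM.resH1 :=
  Quotient.mk HM.resCohomologous Φ

/-- The distinguished point of `H¹(H, M)`: the class of the neutral element `id_M ⊗ η_H` of
`Hom_k(M, M ⊗ H)`. -/
def resH1.base (HM : HopfModule CS M) : HM.resH1 :=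
  resH1.mk HM ⟨1, fun m s => by rw [W.one_apply, W.one_apply, TensorProduct.smul_tmul'],
    fun m => by rw [W.one_apply]; simp, by simp⟩

end HopfModule

end HopfCoh

end

/-! Everything becomes conjugation inside the algebras `W k M A`. Write `c` for the coaction of `M`,
seen in `W k M H`, and `X₁`, `X₂` for the images of `X` under `h ↦ h ⊗ 1` and `h ↦ 1 ⊗ h`. The
antipode makes `c` invertible, coassociativity reads `c₁ c₂ = (id ⊗ Δ)c`, and the cofaces are `b⁰φ =
c (φ ⊗ 1) c⁻¹` and `b⁰Φ = c₁ Φ₂ c₁⁻¹`.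

The main compatibility is that `ω₂` carries `Δ_E ⊗ id` to `b⁰`, where `E = End_S(M)`
(`omega_assoc_endCoact`). On a factor from `E` this is the relation `b²b⁰ = b⁰b¹`; on a factor from
`H` it holds because the second leg commutes with `c₁` (`bb0_scalar`). Together with naturality of
`ω` in the algebra (`omega_map`), it transports `b¹b⁰ = b⁰b⁰` to coassociativity of the coaction on
`E` and gives the isomorphism of diagrams; counitality follows from `(id ⊗ ε)c = 1`.

In degree 1 there is a mismatch: the cocycles of the diagram of units are invertible, with no counit
condition, whereas restricted cocycles are counital, with no invertibility condition. Under the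
cocycle identity the two conditions agree. If `Φ` is counital, the identity says that `Φ c` is again
a coassociative counital coaction, hence invertible by the antipode, and so is `Φ`
(`exists_inverse_of_mem_resZ1`). If `Φ` is invertible, applying `id ⊗ ε` to the two legs in `H ⊗ H`
and cancelling `Φ` forces `(id ⊗ ε)Φ = 1` (`map_counit_of_cocycle`). -/

noncomputable section

namespace HopfCoh

open HopfModule Coalgebra HopfAlgebra

/-! ### Naturality of `ω`, linearity of inverses, and coactions as invertible elements -/

namespace W

section Basic

variable {k M A B C : Type*} [CommRing k] [AddCommGroup M] [Module k M] [Ring A] [Algebra k A]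
  [Ring B] [Algebra k B] [Ring C] [Algebra k C]

theorem map_map (g : A →ₐ[k] B) (h : B →ₐ[k] C) (Φ : W k M A) :
    map M h (map M g Φ) = map M (h.comp g) Φ := by
  ext m
  rw [map_apply, map_apply, map_apply, ← LinearMap.lTensor_comp_apply]
  rfl

theorem map_id (Φ : W k M A) : map M (AlgHom.id k A) Φ = Φ := by
  ext m
  rw [map_apply]
  exact LinearMap.lTensor_id_apply _ _ _

end Basic

section Linear

variable {k M A B S : Type*} [CommRing k] [AddCommGroup M] [Module k M] [Ring A] [Algebra k A]
  [Ring B] [Algebra k B] [Ring S] [Algebra k S] [Module Sᵐᵒᵖ M] [IsScalarTower k Sᵐᵒᵖ M]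

/-- The morphisms `ω` are natural in the algebra `A`. -/
theorem omega_map (g : A →ₐ[k] B) (X : Module.End Sᵐᵒᵖ M ⊗[k] A) :
    (omega k M B S (Algebra.TensorProduct.map (AlgHom.id k _) g X) : W k M B) =
      map M g (omega k M A S X) := by
  induction X with
  | zero => simp
  | tmul f a =>
    ext m
    rw [Algebra.TensorProduct.map_tmul, omega_tmul, map_apply, omega_tmul]
    simp
  | add x y hx hy => simp only [map_add, Subalgebra.coe_add, hx, hy]

/-- Splits a pure tensor into two factors, so that the multiplicative map `b⁰` can be computed on
each separately. -/
theorem omega_eq_const_mul_scalar (f : Module.End Sᵐᵒᵖ M) (a : A) :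
    (omega k M A S (f ⊗ₜ a) : W k M A) = const k M A (endToEnd k M S f) * scalar k M A S a := by
  rw [omega, Algebra.TensorProduct.lift_tmul]
  rfl

/-- The inverse of an `S`-linear element is `S`-linear. -/
theorem mem_linear_of_mul_eq_one {Φ Ψ : W k M A} (hΦ : Φ ∈ linear k M A S) (h : Φ * Ψ = 1)
    (h' : Ψ * Φ = 1) : Ψ ∈ linear k M A S := by
  -- `S`-linearity is commutation with every `rho (s ⊗ₜ 1)`, and a commutant is closed under
  -- inverses.
  rw [mem_linear, linear_iff] at *
  intro s
  calc rho (s ⊗ₜ 1) * Ψ = Ψ * (Φ * rho (s ⊗ₜ 1)) * Ψ := by rw [← mul_assoc, h', one_mul]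
    _ = Ψ * rho (s ⊗ₜ 1) := by rw [← hΦ, mul_assoc, mul_assoc, h, mul_one]

end Linear

section Coaction

variable {k M H : Type*} [CommRing k] [AddCommGroup M] [Module k M] [Ring H] [HopfAlgebra k H]

/-- Counitality becomes an equation in `W k M k` about the value of an algebra morphism, so it
passes to products and inverses. -/
theorem map_counit_eq_one_iff (Ψ : W k M H) :
    map M (Bialgebra.counitAlgHom k H) Ψ = 1 ↔
      ∀ m, TensorProduct.rid k M ((counit (R := k) (A := H)).lTensor M (Ψ m)) = m := by
  constructor
  · intro h m
    have := congrArg (fun Θ : W k M k => TensorProduct.rid k M (Θ m)) h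
    simp only [map_apply, one_apply, TensorProduct.rid_tmul, one_smul] at this
    exact this
  · intro h
    ext m
    apply (TensorProduct.rid k M).injective
    rw [map_apply, one_apply, TensorProduct.rid_tmul, one_smul]
    exact h m

/-- Links the product of two legs with iterated coaction: coassociativity of `Ψ` is thereby a
multiplicative identity in `W k M (H ⊗[k] H)`. -/
theorem inl_mul_inr_apply (Ψ Θ : W k M H) (m : M) :
    (map M (inl k H) Ψ * map M (inr k H) Θ) m =
      TensorProduct.assoc k M H H (Ψ.toLin.rTensor H (Θ m)) := by
  rw [mul_apply, map_apply (inr k H)]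
  induction Θ m with
  | zero => simp
  | tmul x h =>
    rw [LinearMap.lTensor_tmul, extend_tmul, map_apply, LinearMap.rTensor_tmul, toLin_apply]
    induction Ψ x with
    | zero => simp
    | tmul z f => simp
    | add x y hx hy => simp only [map_add, hx, hy, TensorProduct.add_tmul]
  | add x y hx hy => simp only [map_add, hx, hy]

/-- A coassociative counital coaction is invertible in `Hom_k(M, M ⊗ H)`, with inverse
`(id_M ⊗ σ_H) ∘ Ψ`. -/
theorem exists_inverse_of_coaction (Ψ : W k M H)
    (hΔ : map M (inl k H) Ψ * map M (inr k H) Ψ = map M (Bialgebra.comulAlgHom k H) Ψ)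
    (hε : map M (Bialgebra.counitAlgHom k H) Ψ = 1) :
    ∃ Θ : W k M H, Ψ * Θ = 1 ∧ Θ * Ψ = 1 := by
  rw [map_counit_eq_one_iff] at hε
  have hco : ∀ m, TensorProduct.assoc k M H H (Ψ.toLin.rTensor H (Ψ.toLin m)) =
      (comul (R := k) (A := H)).lTensor M (Ψ.toLin m) := fun m => by
    have := congrArg (fun Θ : W k M (H ⊗[k] H) => Θ m) hΔ
    simp only [inl_mul_inr_apply] at this
    exact this
  -- Each product is the iterated coaction followed by `μ(id ⊗ σ)` or `μ(σ ⊗ id)` on the two legs;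
  -- by coassociativity the antipode axiom collapses it to the counit.
  refine ⟨ofLin ((antipode k).lTensor M ∘ₗ Ψ.toLin), ?_, ?_⟩
  · ext m
    rw [one_apply, ← sweedler_right Ψ.toLin hco hε m]
    change Ψ.extend ((antipode k).lTensor M (Ψ.toLin m)) = _
    induction Ψ.toLin m with
    | zero => simp
    | tmul x h =>
      rw [LinearMap.lTensor_tmul, extend_tmul, LinearMap.rTensor_tmul, toLin_apply]
      induction Ψ x with
      | zero => simp
      | tmul y g => simp
      | add x y hx hy => simp only [map_add, hx, hy, TensorProduct.add_tmul]
    | add x y hx hy => simp only [map_add, hx, hy]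
  · ext m
    rw [one_apply, ← sweedler_left Ψ.toLin hco hε m]
    change extend _ (Ψ.toLin m) = _
    induction Ψ.toLin m with
    | zero => simp
    | tmul x h =>
      rw [extend_tmul, LinearMap.rTensor_tmul, ofLin_apply, LinearMap.comp_apply]
      induction Ψ.toLin x with
      | zero => simp
      | tmul y g => simp
      | add x y hx hy => simp only [map_add, hx, hy, TensorProduct.add_tmul]
    | add x y hx hy => simp only [map_add, hx, hy]

end Coaction

end W

namespace HopfModule

variable {k H S : Type*} [CommRing k] [Ring H] [HopfAlgebra k H] [Ring S] [Algebra k S]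
  {CS : ComoduleAlgebra k H S} {M : Type*} [AddCommGroup M] [Module k M] [Module Sᵐᵒᵖ M]
  [IsScalarTower k Sᵐᵒᵖ M]

/-! ### Behaviour of the cofaces under the counit and on generators -/

theorem map_counit_cW (HM : HopfModule CS M) :
    W.map M (Bialgebra.counitAlgHom k H) HM.cW = 1 :=
  (W.map_counit_eq_one_iff _).2 HM.counital

theorem map_counit_cWinv (HM : HopfModule CS M) :
    W.map M (Bialgebra.counitAlgHom k H) HM.cWinv = 1 := by
  have := congrArg (W.map M (Bialgebra.counitAlgHom k H)) HM.cW_mul_cWinv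
  rwa [map_mul, map_counit_cW, one_mul, map_one] at this

/-- Conjugation by the coaction becomes trivial under the counit. This is the source of counitality
of the coaction on `End_S(M)`. -/
theorem map_counit_b0 (HM : HopfModule CS M) (φ : Module.End k M) :
    W.map M (Bialgebra.counitAlgHom k H) (HM.b0 φ) = W.const k M k φ := by
  rw [b0_eq, map_mul, map_mul, map_counit_cW, map_counit_cWinv, map_const, one_mul, mul_one]

/-- `b⁰` sends `m ↦ m ⊗ h` to `m ↦ m ⊗ (1 ⊗ h)`. -/
theorem bb0_scalar (HM : HopfModule CS M) (h : H) :
    HM.bb0 (W.scalar k M H S h) = W.map M (inr k H) (W.scalar k M H S h) := by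
  -- The scalar factor leaves `M` alone and lives in the leg `1 ⊗ H`, while the coaction uses the
  -- leg `H ⊗ 1`; these legs commute in `H ⊗ H`.
  have hcomm : W.map M (inl k H) HM.cW * W.map M (inr k H) (W.scalar k M H S h) =
      W.map M (inr k H) (W.scalar k M H S h) * W.map M (inl k H) HM.cW := by
    ext m
    rw [W.mul_apply, W.mul_apply, W.map_apply, W.scalar_apply, LinearMap.lTensor_tmul,
      W.extend_tmul, W.map_apply]
    induction HM.cW m with
    | zero => simp
    | tmul x g =>
      rw [LinearMap.lTensor_tmul, W.extend_tmul, W.map_apply, W.scalar_apply]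
      simp
    | add x y hx hy => simp only [map_add, hx, hy]
  rw [bb0_eq, hcomm, mul_assoc, inl_cW_mul, mul_one]

theorem bb0_const (HM : HopfModule CS M) (φ : Module.End k M) :
    HM.bb0 (W.const k M H φ) = W.map M (inl k H) (HM.b0 φ) :=
  (HM.bb2_b0 φ).symm

/-! ### Invertibility versus counitality of cocycles -/

/-- The cocycle condition for `Φ` means that `Φ Δ_M` is coassociative. -/
theorem coassoc_of_cocycle (HM : HopfModule CS M) {Φ : W k M H}
    (h : HM.bb2 Φ * HM.bb0 Φ = HM.bb1 Φ) :
    W.map M (inl k H) (Φ * HM.cW) * W.map M (inr k H) (Φ * HM.cW) =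
      W.map M (Bialgebra.comulAlgHom k H) (Φ * HM.cW) := by
  rw [bb0_eq, bb1, bb2] at h
  rw [map_mul _ Φ, map_mul _ Φ, map_mul _ Φ, ← h, ← inl_mul_inr_cW]
  simp only [mul_assoc]
  -- The inner factor `c₁⁻¹ c₁` cancels, which is why `Φ` has to be multiplied by the coaction on
  -- the right.
  rw [← mul_assoc (W.map M (inl k H) HM.cWinv), inl_cWinv_mul, one_mul]

/-- Restricted cocycles are invertible. -/
theorem exists_inverse_of_mem_resZ1 (HM : HopfModule CS M) {Φ : W k M H} (hΦ : Φ ∈ HM.resZ1) :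
    ∃ Θ : W k M H, Φ * Θ = 1 ∧ Θ * Φ = 1 := by
  obtain ⟨-, hε, hc⟩ := hΦ
  obtain ⟨Θ, h, h'⟩ := W.exists_inverse_of_coaction _ (HM.coassoc_of_cocycle hc)
    (by rw [map_mul, (W.map_counit_eq_one_iff Φ).2 hε, map_counit_cW, one_mul])
  -- Here `Θ` inverts `Φ c`, so `c Θ` inverts `Φ = (Φ c) c⁻¹`.
  refine ⟨HM.cW * Θ, by rw [← mul_assoc, h], ?_⟩
  calc HM.cW * Θ * Φ = HM.cW * (Θ * (Φ * HM.cW)) * HM.cWinv := by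
        simp only [mul_assoc, cW_mul_cWinv, mul_one]
    _ = 1 := by rw [h', mul_one, cW_mul_cWinv]

variable (k H) in
/-- The algebra morphism `id_H ⊗ ε_H : H ⊗ H → H`. -/
def idCounit : H ⊗[k] H →ₐ[k] H :=
  (Algebra.TensorProduct.rid k k H).toAlgHom.comp
    (Algebra.TensorProduct.map (AlgHom.id k H) (Bialgebra.counitAlgHom k H))

/-- This and the next two identities evaluate `id ⊗ ε` on the three terms of the cocycle condition:
the first leg survives, the second collapses to scalars, and the comultiplication is undone. -/
theorem idCounit_comp_inl : (idCounit k H).comp (inl k H) = AlgHom.id k H := by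
  ext h
  simp [idCounit]

theorem idCounit_comp_inr : (idCounit k H).comp (inr k H) =
    (Algebra.ofId k H).comp (Bialgebra.counitAlgHom k H) := by
  ext h
  simp [idCounit, Algebra.ofId_apply, Algebra.algebraMap_eq_smul_one]

theorem idCounit_comp_comul :
    (idCounit k H).comp (Bialgebra.comulAlgHom k H) = AlgHom.id k H := by
  ext h
  change TensorProduct.rid k H ((counit (R := k) (A := H)).lTensor H (comul h)) = h
  rw [Coalgebra.lTensor_counit_comul]
  simp

/-- Invertible cocycles are counital. -/
theorem map_counit_of_cocycle (HM : HopfModule CS M) {Φ Θ : W k M H} (hΘ : Θ * Φ = 1)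
    (h : HM.bb2 Φ * HM.bb0 Φ = HM.bb1 Φ) : W.map M (Bialgebra.counitAlgHom k H) Φ = 1 := by
  -- With `η` the unit of `H`, the cocycle identity turns into `Φ · (c · (id ⊗ ηε)Φ · c⁻¹) = Φ`. The
  -- left inverse of `Φ` and conjugation by `c` then isolate the middle factor.
  have h1 := congrArg (W.map M (idCounit k H)) h
  rw [bb0_eq, bb1, bb2] at h1
  simp only [map_mul, W.map_map, idCounit_comp_inl, idCounit_comp_inr, idCounit_comp_comul,
    W.map_id] at h1
  have h2 : W.map M ((Algebra.ofId k H).comp (Bialgebra.counitAlgHom k H)) Φ = 1 := by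
    have h3 := congrArg (fun x => HM.cWinv * (Θ * x) * HM.cW) h1
    simp only [← mul_assoc, hΘ, one_mul, cWinv_mul_cW] at h3
    simpa only [mul_assoc, cWinv_mul_cW, mul_one] using h3
  -- A second application of the counit removes the unit map, since `ε η ε = ε`.
  have h4 := congrArg (W.map M (Bialgebra.counitAlgHom k H)) h2
  rw [W.map_map, map_one, ← AlgHom.comp_assoc] at h4
  convert h4 using 2
  ext h
  simp

/-! ### The comodule algebra `End_S(M)` and the isomorphism of diagrams -/

/-- The coaction `ω₁⁻¹ ∘ b⁰` of `H` on `End_S(M)`. -/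
def endCoact (HM : HopfModule CS M) (hF₁ : W.ConditionF k M H S) :
    Module.End Sᵐᵒᵖ M →ₐ[k] Module.End Sᵐᵒᵖ M ⊗[k] H :=
  (AlgEquiv.ofBijective (W.omega k M H S) hF₁).symm.toAlgHom.comp HM.b0S

theorem omega_endCoact (HM : HopfModule CS M) (hF₁ : W.ConditionF k M H S)
    (φ : Module.End Sᵐᵒᵖ M) : W.omega k M H S (HM.endCoact hF₁ φ) = HM.b0S φ :=
  (AlgEquiv.ofBijective (W.omega k M H S) hF₁).apply_symm_apply _

/-- Both sides are additive, so pure tensors `f ⊗ h` suffice; there `b⁰` acts on `f` by conjugation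
in the first leg and moves `h` to the second leg. This serves both coassociativity and the
compatibility of `ω₂` with `d⁰`. -/
theorem omega_assoc_endCoact (HM : HopfModule CS M) (hF₁ : W.ConditionF k M H S)
    (X : Module.End Sᵐᵒᵖ M ⊗[k] H) :
    W.omega k M (H ⊗[k] H) S (Algebra.TensorProduct.assoc k k k _ H H
      (Algebra.TensorProduct.map (HM.endCoact hF₁) (AlgHom.id k H) X)) =
      HM.bb0S (W.omega k M H S X) := by
  induction X with
  | zero => simp
  | tmul f h =>
    apply Subtype.ext
    change _ = HM.bb0 (W.omega k M H S (f ⊗ₜ[k] h))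
    rw [W.omega_eq_const_mul_scalar, map_mul, bb0_const, bb0_scalar,
      show HM.b0 (W.endToEnd k M S f) = W.omega k M H S (HM.endCoact hF₁ f) by
        rw [omega_endCoact]; rfl,
      Algebra.TensorProduct.map_tmul, AlgHom.id_apply]
    ext m
    rw [W.mul_apply, W.map_apply, W.scalar_apply, LinearMap.lTensor_tmul, W.extend_tmul,
      W.map_apply]
    induction HM.endCoact hF₁ f with
    | zero => simp [W.zero_apply]
    | tmul f g => simp
    | add x y hx hy =>
      simp only [map_add, hx, hy, TensorProduct.add_tmul, Subalgebra.coe_add, W.add_apply]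
  | add x y hx hy => simp only [map_add, hx, hy]

/-- The comodule algebra structure on `End_S(M)` with coaction `ω₁⁻¹ ∘ b⁰`. -/
def endComoduleAlgebra (HM : HopfModule CS M) (hF₁ : W.ConditionF k M H S)
    (hF₂ : W.ConditionF k M (H ⊗[k] H) S) : ComoduleAlgebra k H (Module.End Sᵐᵒᵖ M) where
  coact := HM.endCoact hF₁
  coassoc φ := by
    -- Coassociativity is tested after the injective map `ω₂`, where it becomes `b⁰b⁰ = b¹b⁰`.
    apply hF₂.1
    refine (HM.omega_assoc_endCoact hF₁ _).trans (Subtype.ext ?_)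
    refine Eq.trans ?_ (W.omega_map (Bialgebra.comulAlgHom k H) (HM.endCoact hF₁ φ)).symm
    rw [omega_endCoact]
    exact (HM.bb1_b0 _).symm
  counital φ := by
    have h1 := W.omega_map (Bialgebra.counitAlgHom k H) (HM.endCoact hF₁ φ)
    rw [omega_endCoact] at h1
    have h2 := h1.trans (HM.map_counit_b0 _)
    -- Every element of `End_S(M) ⊗ k` has the form `ψ ⊗ 1`, so no injectivity of `ω` over `k` has
    -- to be assumed: evaluation at each `m` gives `ψ = φ`.
    obtain ⟨ψ, hψ⟩ : ∃ ψ, Algebra.TensorProduct.map (AlgHom.id k _)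
        (Bialgebra.counitAlgHom k H) (HM.endCoact hF₁ φ) = ψ ⊗ₜ 1 :=
      ⟨TensorProduct.rid k _ (Algebra.TensorProduct.map (AlgHom.id k _)
        (Bialgebra.counitAlgHom k H) (HM.endCoact hF₁ φ)),
        (TensorProduct.rid k _).injective (by simp)⟩
    change TensorProduct.rid k _ (Algebra.TensorProduct.map (AlgHom.id k _)
      (Bialgebra.counitAlgHom k H) (HM.endCoact hF₁ φ)) = φ
    rw [hψ] at h2 ⊢
    ext m
    have := congrArg (fun Θ : W k M k => TensorProduct.rid k M (Θ m)) h2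
    simp only [W.omega_tmul, W.const_apply, TensorProduct.rid_tmul, one_smul] at this
    rw [TensorProduct.rid_tmul, one_smul]
    exact this

/-- The isomorphism of pre-cosimplicial groups induced by `ω₀ = id`, `ω₁` and `ω₂`. -/
def endUnitsIso (HM : HopfModule CS M) (hF₁ : W.ConditionF k M H S)
    (hF₂ : W.ConditionF k M (H ⊗[k] H) S) :
    (HM.endComoduleAlgebra hF₁ hF₂).unitsDiagram.Iso HM.unitsDiagram where
  e₀ := MulEquiv.refl _
  e₁ := Units.mapEquiv (AlgEquiv.ofBijective (W.omega k M H S) hF₁).toMulEquiv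
  e₂ := Units.mapEquiv (AlgEquiv.ofBijective (W.omega k M (H ⊗[k] H) S) hF₂).toMulEquiv
  comm_c0 x := Units.ext (HM.omega_endCoact hF₁ x)
  comm_c1 x := Units.ext (Subtype.ext (W.ext fun m => W.omega_tmul _ _ m))
  comm_d0 X := Units.ext (HM.omega_assoc_endCoact hF₁ X)
  comm_d1 X := Units.ext (Subtype.ext (W.omega_map _ _))
  comm_d2 X := Units.ext (Subtype.ext (by
    -- Up to reassociation, `X ↦ X ⊗ 1` is `id ⊗ (h ↦ h ⊗ 1)`, so naturality of `ω` applies here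
    -- too.
    refine Eq.trans ?_ (W.omega_map (inl k H) (X : Module.End Sᵐᵒᵖ M ⊗[k] H))
    refine congrArg (fun Y => (W.omega k M (H ⊗[k] H) S Y : W k M (H ⊗[k] H))) ?_
    change ComoduleAlgebra.d2 k H _ (X : Module.End Sᵐᵒᵖ M ⊗[k] H) = _
    induction (X : Module.End Sᵐᵒᵖ M ⊗[k] H) with
    | zero => simp
    | tmul f h => simp [ComoduleAlgebra.d2]
    | add x y hx hy => simp only [map_add, hx, hy]))

/-! ### Restricted cocycles as cocycles of the diagram of units -/

/-- An invertible element of `Hom_S(M, M ⊗ H)` which is a cocycle of the pre-cosimplicial group of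
units is a restricted cocycle. -/
theorem mem_resZ1_of_mem_Z1 (HM : HopfModule CS M) {Φ : (W.linear k M H S)ˣ}
    (h : Φ ∈ HM.unitsDiagram.Z1) : ((Φ : W.linear k M H S) : W k M H) ∈ HM.resZ1 := by
  have hc : HM.bb2 (Φ : W.linear k M H S) * HM.bb0 (Φ : W.linear k M H S) =
      HM.bb1 (Φ : W.linear k M H S) :=
    congrArg Subtype.val (congrArg Units.val (show HM.unitsDiagram.d2 Φ * HM.unitsDiagram.d0 Φ =
      HM.unitsDiagram.d1 Φ from h))
  refine ⟨fun m s => Φ.1.2 s m, (W.map_counit_eq_one_iff _).1 (HM.map_counit_of_cocycle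
    (Θ := ((Φ⁻¹ : (W.linear k M H S)ˣ) : W.linear k M H S)) ?_ hc), hc⟩
  exact congrArg Subtype.val Φ.inv_mul

/-- The inverse found in `Hom_k(M, M ⊗ H)` is automatically `S`-linear, so a restricted cocycle is a
unit of the smaller algebra. -/
theorem exists_unit_of_mem_resZ1 (HM : HopfModule CS M) {Φ : W k M H} (hΦ : Φ ∈ HM.resZ1) :
    ∃ U ∈ HM.unitsDiagram.Z1, ((U : W.linear k M H S) : W k M H) = Φ := by
  obtain ⟨Θ, h, h'⟩ := HM.exists_inverse_of_mem_resZ1 hΦ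
  have hmem : Φ ∈ W.linear k M H S := fun s m => hΦ.1 m s
  exact ⟨⟨⟨Φ, hmem⟩, ⟨Θ, W.mem_linear_of_mul_eq_one hmem h h'⟩, Subtype.ext h, Subtype.ext h'⟩,
    Units.ext (Subtype.ext hΦ.2.2), rfl⟩

/-- The bijection between the cocycles of the pre-cosimplicial group of units and the restricted
cocycles. -/
def unitsZ1Equiv (HM : HopfModule CS M) : HM.unitsDiagram.Z1 ≃ HM.resZ1 :=
  Equiv.ofBijective (fun Φ => ⟨_, HM.mem_resZ1_of_mem_Z1 Φ.2⟩)
    ⟨fun _ _ h => Subtype.ext (Units.ext (Subtype.ext (Subtype.mk.inj h))),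
      fun Φ => by
        obtain ⟨U, hU, h⟩ := HM.exists_unit_of_mem_resZ1 Φ.2
        exact ⟨⟨U, hU⟩, Subtype.ext h⟩⟩

/-- The bijection `H¹` of the pre-cosimplicial group of units `≃ H¹(H, M)`. -/
def unitsH1Equiv (HM : HopfModule CS M) : HM.unitsDiagram.H1 ≃ HM.resH1 :=
  Quotient.congr HM.unitsZ1Equiv fun _ _ => exists_congr fun _ =>
    ⟨fun h => congrArg (fun x : (W.linear k M H S)ˣ => ((x : W.linear k M H S) : W k M H)) h,
      fun h => Units.ext (Subtype.ext h)⟩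

end HopfModule

/-! ### Invariance of the cohomology sets under isomorphism -/

namespace PreCosimplicialGroup

variable {A₀ A₁ A₂ B₀ B₁ B₂ : Type*} [Group A₀] [Group A₁] [Group A₂] [Group B₀] [Group B₁]
  [Group B₂] {P : PreCosimplicialGroup A₀ A₁ A₂} {Q : PreCosimplicialGroup B₀ B₁ B₂}

theorem Iso.mem_H0_iff (e : P.Iso Q) (x : A₀) : e.e₀ x ∈ Q.H0 ↔ x ∈ P.H0 := by
  change Q.c1 (e.e₀ x) = Q.c0 (e.e₀ x) ↔ P.c1 x = P.c0 x
  rw [← e.comm_c0, ← e.comm_c1, e.e₁.injective.eq_iff]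

theorem Iso.mem_Z1_iff (e : P.Iso Q) (X : A₁) : X ∈ P.Z1 ↔ e.e₁ X ∈ Q.Z1 := by
  change P.d2 X * P.d0 X = P.d1 X ↔ Q.d2 (e.e₁ X) * Q.d0 (e.e₁ X) = Q.d1 (e.e₁ X)
  rw [← e.comm_d0, ← e.comm_d1, ← e.comm_d2, ← map_mul, e.e₂.injective.eq_iff]

/-- The bijection between the `1`-cohomology sets induced by an isomorphism. -/
def Iso.h1Equiv (e : P.Iso Q) : P.H1 ≃ Q.H1 :=
  Quotient.congr (e.e₁.toEquiv.subtypeEquiv e.mem_Z1_iff) fun X Y => by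
    refine e.e₀.toEquiv.exists_congr fun x => ?_
    change (Y : A₁) = P.c1 x⁻¹ * X * P.c0 x ↔
      e.e₁ Y = Q.c1 (e.e₀ x)⁻¹ * e.e₁ X * Q.c0 (e.e₀ x)
    rw [← map_inv e.e₀, ← e.comm_c0, ← e.comm_c1, ← map_mul, ← map_mul, e.e₁.injective.eq_iff]

end PreCosimplicialGroup

end HopfCoh

end

theorem theorem2p6 {k H S M : Type*} [CommRing k] [Ring H] [HopfAlgebra k H]
    [Ring S] [Algebra k S] [AddCommGroup M] [Module k M] [Module Sᵐᵒᵖ M] [IsScalarTower k Sᵐᵒᵖ M]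
    (CS : HopfCoh.ComoduleAlgebra k H S) (HM : HopfCoh.HopfModule CS M)
    (hF₁ : HopfCoh.W.ConditionF k M H S) (hF₂ : HopfCoh.W.ConditionF k M (H ⊗[k] H) S) :
    -- the comodule algebra structure `ω₁⁻¹ ∘ b⁰` on `End_S(M)`
    ∃ CE : HopfCoh.ComoduleAlgebra k H (Module.End Sᵐᵒᵖ M),
      (∀ φ, HopfCoh.W.omega k M H S (CE.coact φ) = HM.b0S φ) ∧
      -- the isomorphism of pre-cosimplicial groups given by `ω₀ = id`, `ω₁`, `ω₂`
      (∃ e : CE.unitsDiagram.Iso HM.unitsDiagram,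
        (∀ x, e.e₀ x = x) ∧
        (∀ X : (Module.End Sᵐᵒᵖ M ⊗[k] H)ˣ,
          (e.e₁ X : HopfCoh.W.linear k M H S) = HopfCoh.W.omega k M H S X) ∧
        (∀ X : (Module.End Sᵐᵒᵖ M ⊗[k] (H ⊗[k] H))ˣ,
          (e.e₂ X : HopfCoh.W.linear k M (H ⊗[k] H) S) =
            HopfCoh.W.omega k M (H ⊗[k] H) S X)) ∧
      -- the equality of groups in degree `0`
      CE.genH0 = HM.resH0 ∧
      -- the isomorphism of pointed sets in degree `1`, induced by `ω₁`
      ∃ e : CE.genH1 ≃ HM.resH1,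
        e (HopfCoh.ComoduleAlgebra.genH1.base CE) = HopfCoh.HopfModule.resH1.base HM ∧
        ∀ X : CE.genZ1, ∃ Φ : HM.resZ1,
          (Φ : HopfCoh.W k M H) =
            HopfCoh.W.omega k M H S ((X : (Module.End Sᵐᵒᵖ M ⊗[k] H)ˣ) : Module.End Sᵐᵒᵖ M ⊗[k] H) ∧
          e (HopfCoh.ComoduleAlgebra.genH1.mk CE X) = HopfCoh.HopfModule.resH1.mk HM Φ := by
  refine ⟨HM.endComoduleAlgebra hF₁ hF₂, HM.omega_endCoact hF₁, ⟨HM.endUnitsIso hF₁ hF₂,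
    fun _ => rfl, fun _ => rfl, fun _ => rfl⟩, ?_, ?_⟩
  · ext x
    refine ((HM.endUnitsIso hF₁ hF₂).mem_H0_iff x).symm.trans ?_
    -- The diagram states the equation among units of `Hom_S(M, M ⊗ H)`, `resH0` states it in
    -- `Hom_k(M, M ⊗ H)`; the inclusion is injective.
    exact ⟨fun h => congrArg Subtype.val (congrArg Units.val
      (show HM.unitsDiagram.c1 x = HM.unitsDiagram.c0 x from h)),
      fun h => Units.ext (Subtype.ext h)⟩
  · refine ⟨(HM.endUnitsIso hF₁ hF₂).h1Equiv.trans HM.unitsH1Equiv, ?_, fun X =>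
      ⟨⟨_, HM.mem_resZ1_of_mem_Z1 (((HM.endUnitsIso hF₁ hF₂).mem_Z1_iff X).1 X.2)⟩, rfl, rfl⟩⟩
    -- Already as cocycles the base points correspond, because `ω₁` is unital.
    refine congrArg (HopfCoh.HopfModule.resH1.mk HM) (Subtype.ext ?_)
    change ((HopfCoh.W.omega k M H S 1 : HopfCoh.W.linear k M H S) : HopfCoh.W k M H) = 1
    rw [map_one, OneMemClass.coe_one]
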